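/- Let $n \ge 1$. There is a constant $\epsilon_n > 0$, depending only on $n$, with the following property. Let $(M^n, g)$ be a closed (that is, compact and without boundary) smooth Riemannian manifold of dimension $n$, with its Riemannian distance $d$ and Riemannian volume, and let $R > 0$. If every ball of radius $R$ in $(M, g)$ has volume at most $\epsilon_n R^n$, then the Uryson $(n-1)$-width of $(M, g)$ is at most $R$: there are a simplicial complex $Y$ of dimension at most $n-1$ and a continuous map $\pi : M \to Y$ such that every fiber $\pi^{-1}(y)$, $y \in Y$, has diameter at most $R$ in $M$, i.e. $d(x_1, x_2) \le R$ whenever $\pi(x_1) = \pi(x_2)$. -/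

import Mathlib

open scoped Manifold ContDiff ENNReal
open MeasureTheory Bundle

noncomputable section

/-- A compact metric space `X` has Uryson `q`-width at most `W` if there are a simplicial complex
`Y` of dimension at most `q` and a continuous map `f : X → Y` all of whose fibres have diameter at
most `W`. The complex is taken finite and realized linearly in some `ℝ^N`; as `X` is compact, this
loses nothing, because the image of `X` in any complex lies in a finite subcomplex. Distances may
be infinite, which lets `X` be a disconnected Riemannian manifold. -/
def HasUrysonWidthLE (X : Type*) [PseudoEMetricSpace X] [CompactSpace X] (q : ℕ) (W : ℝ≥0∞) :
    Prop :=
  ∃ (N : ℕ) (Y : Geometry.SimplicialComplex ℝ (EuclideanSpace ℝ (Fin N))) (f : X → Y.space),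
    Y.faces.Finite ∧ (∀ s ∈ Y.faces, s.card ≤ q + 1) ∧
      Continuous f ∧ ∀ y : Y.space, Metric.ediam (f ⁻¹' {y}) ≤ W

section Volume

variable {n : ℕ} {M : Type*} [TopologicalSpace M] [ChartedSpace (EuclideanSpace ℝ (Fin n)) M]

/-- The coordinate vector `∂ᵢ` of the preferred chart at `x`, at the point of `M` which has
coordinates `y` in this chart. -/
def coordVector (x : M) (y : EuclideanSpace ℝ (Fin n)) (i : Fin n) :
    TangentSpace (𝓡 n) ((extChartAt (𝓡 n) x).symm y) :=
  mfderiv 𝓘(ℝ, EuclideanSpace ℝ (Fin n)) (𝓡 n) (extChartAt (𝓡 n) x).symm y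
    (EuclideanSpace.single i (1 : ℝ) : EuclideanSpace ℝ (Fin n))

variable [RiemannianBundle (fun x : M ↦ TangentSpace (𝓡 n) x)]

/-- The matrix `gᵢⱼ = ⟨∂ᵢ, ∂ⱼ⟩` of the Riemannian metric in the preferred chart at `x`, at the
coordinates `y`. -/
def metricMatrix (x : M) (y : EuclideanSpace ℝ (Fin n)) : Matrix (Fin n) (Fin n) ℝ :=
  Matrix.gram ℝ (coordVector x y)

variable [MeasurableSpace M]

/-- The measure `√(det gᵢⱼ) dy¹ ⋯ dyⁿ` of the preferred chart at `x`, carried to the domain of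
this chart in `M`. -/
def chartVolume (x : M) : Measure M :=
  ((volume.restrict (extChartAt (𝓡 n) x).target).withDensity fun y ↦
    ENNReal.ofReal (√(metricMatrix x y).det)).map (extChartAt (𝓡 n) x).symm

variable (n M) in
/-- The Riemannian volume measure of `M`. The measures `√(det gᵢⱼ) dy¹ ⋯ dyⁿ` of the charts are the
restrictions of one measure to the chart domains; that measure is their supremum, the least measure
which dominates all of them. -/
def riemannianVolume : Measure M :=
  ⨆ x : M, chartVolume (n := n) x

end Volume

end

/-! Volume enters only through finite covers: a set has small `n`-dimensional content when finitely
many sets of small size cover it with a small sum of `n`-th powers of sizes. The theorem then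
becomes a statement about compact metric spaces, `exists_isClosedCover`, proved by induction on `n`.

In the induction step, consider disjoint families of open sets of diameter at most `R`, together
with a cover of the remaining set `Z`, and choose a pair for which the cover has nearly minimal
content in one dimension less. Such a `Z` is locally small: by the coarea inequality
`IsSmallCover.exists_sphere`, a ball around `x` has a cheap sphere, and adding its interior as a new
piece trades the part of `Z` inside for that sphere. Near minimality bounds what was traded
(`exists_isSeparatingCover`). By induction `Z` has a closed cover of multiplicity `n`. Slightly
thickened, it leaves over a compact set that the disjoint pieces split into closed parts, so the
multiplicity rises by one only (`IsClosedCover.extend`). A map to the nerve of the final cover gives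
the width bound.

For a Riemannian manifold, very small balls have volume at least a dimensional constant times the
`n`-th power of the radius (`exists_le_riemannianVolume_eball`). A maximal separated set therefore
turns a volume bound into a content bound (`exists_isSmallCover_of_measure_le`). The scale at which
this holds depends on the manifold, which is harmless because the covering theorem only bounds sizes
from above. -/

/-! ### Finite covers, coarea and nearly minimal separating sets -/

section Covers

open Set Metric

variable {X : Type*} [PseudoEMetricSpace X]

/-- A finite family `s` of sets with assigned sizes in `(0, δ]`, each set having diameter at most
its size, which covers `A`. -/
structure IsSmallCover (s : Finset (Set X × ℝ)) (A : Set X) (δ : ℝ) : Prop where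
  pos : ∀ p ∈ s, 0 < p.2
  le : ∀ p ∈ s, p.2 ≤ δ
  ediam_le : ∀ p ∈ s, ediam p.1 ≤ ENNReal.ofReal p.2
  subset : A ⊆ ⋃ p ∈ s, p.1

lemma IsSmallCover.mono {s : Finset (Set X × ℝ)} {A B : Set X} {δ : ℝ} (h : IsSmallCover s A δ)
    (hBA : B ⊆ A) : IsSmallCover s B δ :=
  ⟨h.pos, h.le, h.ediam_le, hBA.trans h.subset⟩

lemma IsSmallCover.mono_size {s : Finset (Set X × ℝ)} {A : Set X} {δ δ' : ℝ}
    (h : IsSmallCover s A δ) (hδ : δ ≤ δ') : IsSmallCover s A δ' :=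
  ⟨h.pos, fun p hp ↦ (h.le p hp).trans hδ, h.ediam_le, h.subset⟩

open Classical in
/-- The members of a cover of `A` which meet `B ⊆ A` already cover `B`. -/
lemma IsSmallCover.filter {s : Finset (Set X × ℝ)} {A B : Set X} {δ : ℝ}
    (h : IsSmallCover s A δ) (hBA : B ⊆ A) :
    IsSmallCover (s.filter fun p ↦ (p.1 ∩ B).Nonempty) B δ where
  pos p hp := h.pos p (Finset.mem_filter.1 hp).1
  le p hp := h.le p (Finset.mem_filter.1 hp).1
  ediam_le p hp := h.ediam_le p (Finset.mem_filter.1 hp).1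
  subset y hy := by
    obtain ⟨p, hp, hyp⟩ := mem_iUnion₂.1 (h.subset (hBA hy))
    exact mem_iUnion₂.2 ⟨p, Finset.mem_filter.2 ⟨hp, y, hyp, hy⟩, hyp⟩

/-- The distances to a fixed point realized on a set of diameter `d` have diameter at most `d`. -/
lemma ediam_setOf_edist_eq_le (x : X) (A : Set X) :
    ediam {t : ℝ | 0 ≤ t ∧ ∃ y ∈ A, edist y x = ENNReal.ofReal t} ≤ ediam A := by
  refine ediam_le ?_
  rintro t ⟨ht, y, hy, hyt⟩ u ⟨hu, z, hz, hzu⟩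
  refine le_trans ?_ (edist_le_ediam_of_mem hy hz)
  wlog htu : u ≤ t generalizing t u y z
  · rw [edist_comm, edist_comm y]
    exact this u hu z hz hzu t ht y hy hyt (le_of_not_ge htu)
  rw [edist_dist, Real.dist_eq, abs_of_nonneg (by linarith), ENNReal.ofReal_sub _ hu, ← hyt, ← hzu]
  exact tsub_le_iff_right.2 (edist_triangle _ _ _)

open Classical in
/-- The coarea inequality for finite covers: some sphere around `x` of radius in `(a, b)` has a
cover whose `n`-dimensional size is bounded by the `n + 1`-dimensional size of a cover of the
ball. -/
lemma IsSmallCover.exists_sphere {s : Finset (Set X × ℝ)} {K : Set X} {x : X} {δ a b : ℝ}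
    (ha : 0 ≤ a) (hab : a < b) (h : IsSmallCover s (K ∩ closedEBall x (ENNReal.ofReal b)) δ)
    (n : ℕ) : ∃ t ∈ Ioo a b, ∃ s' : Finset (Set X × ℝ),
      IsSmallCover s' (K ∩ {y | edist y x = ENNReal.ofReal t}) δ ∧
        (b - a) * ∑ p ∈ s', p.2 ^ n ≤ ∑ p ∈ s, p.2 ^ (n + 1) := by
  -- `J p` contains the radii of the spheres that meet `p.1`; the closure makes it measurable
  -- without increasing its diameter, so its length is at most `p.2`.
  let J : Set X × ℝ → Set ℝ := fun p ↦
    closure {t : ℝ | 0 ≤ t ∧ ∃ y ∈ p.1, edist y x = ENNReal.ofReal t}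
  let f : ℝ → ℝ≥0∞ := fun t ↦
    ∑ p ∈ s, (J p).indicator (fun _ ↦ ENNReal.ofReal (p.2 ^ n)) t
  have hJ (p) (hp : p ∈ s) : volume (J p) ≤ ENNReal.ofReal p.2 := by
    refine (Real.volume_le_diam _).trans ?_
    rw [ediam_closure]
    exact (ediam_setOf_edist_eq_le x p.1).trans (h.ediam_le p hp)
  have hJm (p) : MeasurableSet (J p) := isClosed_closure.measurableSet
  have hfm : Measurable f :=
    Finset.measurable_fun_sum _ fun p _ ↦ measurable_const.indicator (hJm p)
  have hint : ∫⁻ t in Ioo a b, f t ≤ ENNReal.ofReal (∑ p ∈ s, p.2 ^ (n + 1)) := by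
    rw [ENNReal.ofReal_sum_of_nonneg fun p hp ↦ pow_nonneg (h.pos p hp).le _]
    refine (setLIntegral_le_lintegral _ _).trans ?_
    rw [lintegral_finsetSum _ fun p _ ↦ measurable_const.indicator (hJm p)]
    refine Finset.sum_le_sum fun p hp ↦ ?_
    rw [lintegral_indicator (hJm p), setLIntegral_const, pow_succ,
      ENNReal.ofReal_mul (pow_nonneg (h.pos p hp).le _)]
    gcongr
    exact hJ p hp
  have hvol : volume (Ioo a b) = ENNReal.ofReal (b - a) := Real.volume_Ioo
  -- Some radius does no worse than the average of `f`, and `f t` dominates the cost of the members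
  -- that meet the sphere of radius `t`.
  obtain ⟨t, ht, hft⟩ := exists_le_setLAverage (μ := volume) (s := Ioo a b) (f := f)
    (by rw [hvol]; simpa using hab) (by rw [hvol]; simp) hfm.aemeasurable
  refine ⟨t, ht, s.filter fun p ↦ (p.1 ∩ (K ∩ {y | edist y x = ENNReal.ofReal t})).Nonempty,
    h.filter (inter_subset_inter_right _ fun y hy ↦ ?_), ?_⟩
  · rw [mem_closedEBall, show edist y x = _ from hy]
    exact ENNReal.ofReal_le_ofReal ht.2.le
  have h1 : ENNReal.ofReal (∑ p ∈ s.filter fun p ↦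
      (p.1 ∩ (K ∩ {y | edist y x = ENNReal.ofReal t})).Nonempty, p.2 ^ n) ≤ f t := by
    rw [ENNReal.ofReal_sum_of_nonneg fun p hp ↦
      pow_nonneg (h.pos p (Finset.mem_filter.1 hp).1).le _, Finset.sum_filter]
    refine Finset.sum_le_sum fun p hp ↦ ?_
    split_ifs with hne
    · obtain ⟨y, hy, -, hyt⟩ := hne
      rw [indicator_of_mem]
      exact subset_closure ⟨ha.trans ht.1.le, y, hy, hyt⟩
    · exact zero_le
  have h2 : ENNReal.ofReal (b - a) * f t ≤ ENNReal.ofReal (∑ p ∈ s, p.2 ^ (n + 1)) := by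
    refine le_trans ?_ hint
    rw [setLAverage_eq, hvol] at hft
    refine (mul_le_mul_right hft _).trans ?_
    rw [ENNReal.mul_div_cancel (by simpa using hab) (by simp)]
  have h3 := (mul_le_mul_right h1 (ENNReal.ofReal (b - a))).trans h2
  rw [← ENNReal.ofReal_mul (by linarith)] at h3
  exact (ENNReal.ofReal_le_ofReal_iff
    (Finset.sum_nonneg fun p hp ↦ pow_nonneg (h.pos p hp).le _)).1 h3

/-- Pairwise disjoint open sets of diameter at most `R`, with a cover by sets of size at most `δ`
of the part of `K` which they miss. -/
structure IsSeparatingCover (K : Set X) (R δ : ℝ) (𝒰 : Set (Set X)) (s : Finset (Set X × ℝ)) :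
    Prop where
  isOpen : ∀ U ∈ 𝒰, IsOpen U
  disjoint : 𝒰.PairwiseDisjoint id
  ediam_le : ∀ U ∈ 𝒰, ediam U ≤ ENNReal.ofReal R
  cover : IsSmallCover s (K \ ⋃₀ 𝒰) δ

open Classical in
/-- Inserting a ball as a new piece: the part of the separating set inside the ball is replaced by
the sphere. -/
lemma IsSeparatingCover.insert_ball {K : Set X} {R δ t : ℝ} {𝒰 : Set (Set X)}
    {s s' : Finset (Set X × ℝ)} {x : X} (h : IsSeparatingCover K R δ 𝒰 s) (htR : 2 * t ≤ R)
    (h' : IsSmallCover s' (K ∩ {y | edist y x = ENNReal.ofReal t}) δ) :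
    IsSeparatingCover K R δ
      (insert (eball x (ENNReal.ofReal t)) ((· \ closedEBall x (ENNReal.ofReal t)) '' 𝒰))
      ((s.filter fun p ↦ ¬ p.1 ⊆ eball x (ENNReal.ofReal t)) ∪ s') where
  isOpen := by
    rintro U (rfl | ⟨V, hV, rfl⟩)
    · exact isOpen_eball
    · exact (h.isOpen V hV).sdiff isClosed_closedEBall
  disjoint := by
    refine PairwiseDisjoint.insert ?_ ?_
    · rintro _ ⟨U, hU, rfl⟩ _ ⟨V, hV, rfl⟩ hne
      have hUV : U ≠ V := fun h ↦ hne (by rw [h])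
      exact (h.disjoint hU hV hUV).mono sdiff_subset sdiff_subset
    · rintro _ ⟨U, hU, rfl⟩ -
      exact disjoint_left.2 fun y hy hy' ↦ hy'.2 (eball_subset_closedEBall hy)
  ediam_le := by
    rintro U (rfl | ⟨V, hV, rfl⟩)
    · refine ediam_eball_le.trans ?_
      rw [← ENNReal.ofReal_ofNat 2, ← ENNReal.ofReal_mul (by norm_num)]
      exact ENNReal.ofReal_le_ofReal htR
    · exact (ediam_mono sdiff_subset).trans (h.ediam_le V hV)
  cover :=
    { pos := fun p hp ↦ (Finset.mem_union.1 hp).elim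
        (fun hp ↦ h.cover.pos p (Finset.mem_filter.1 hp).1) (h'.pos p)
      le := fun p hp ↦ (Finset.mem_union.1 hp).elim
        (fun hp ↦ h.cover.le p (Finset.mem_filter.1 hp).1) (h'.le p)
      ediam_le := fun p hp ↦ (Finset.mem_union.1 hp).elim
        (fun hp ↦ h.cover.ediam_le p (Finset.mem_filter.1 hp).1) (h'.ediam_le p)
      subset := by
        rintro y ⟨hyK, hy⟩
        rw [sUnion_insert, mem_union, not_or] at hy
        have hy1 : ENNReal.ofReal t ≤ edist y x := not_lt.1 hy.1
        rcases hy1.eq_or_lt with hyt | hyt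
        · obtain ⟨p, hp, hyp⟩ := mem_iUnion₂.1 (h'.subset ⟨hyK, hyt.symm⟩)
          exact mem_iUnion₂.2 ⟨p, Finset.mem_union_right _ hp, hyp⟩
        · have hy2 : y ∉ ⋃₀ 𝒰 := by
            rintro ⟨U, hU, hyU⟩
            exact hy.2 ⟨_, ⟨U, hU, rfl⟩, hyU, not_le.2 hyt⟩
          obtain ⟨p, hp, hyp⟩ := mem_iUnion₂.1 (h.cover.subset ⟨hyK, hy2⟩)
          exact mem_iUnion₂.2 ⟨p, Finset.mem_union_left _
            (Finset.mem_filter.2 ⟨hp, fun hsub ↦ hy.1 (hsub hyp)⟩), hyp⟩ }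

lemma exists_isSmallCover [CompactSpace X] (A : Set X) {δ : ℝ} (hδ : 0 < δ) :
    ∃ s, IsSmallCover s A δ := by
  classical
  obtain ⟨t, -, ht⟩ := (isCompact_univ (X := X)).elim_nhds_subcover
    (fun x ↦ eball x (ENNReal.ofReal (δ / 2))) fun x _ ↦ eball_mem_nhds _ (by simpa using hδ)
  refine ⟨t.image fun x ↦ (eball x (ENNReal.ofReal (δ / 2)), δ), ?_, ?_, ?_, ?_⟩
  · simp only [Finset.mem_image]
    rintro _ ⟨x, -, rfl⟩
    exact hδ
  · simp only [Finset.mem_image]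
    rintro _ ⟨x, -, rfl⟩
    exact le_rfl
  · simp only [Finset.mem_image]
    rintro _ ⟨x, -, rfl⟩
    refine ediam_eball_le.trans ?_
    rw [← ENNReal.ofReal_ofNat 2, ← ENNReal.ofReal_mul (by norm_num)]
    exact ENNReal.ofReal_le_ofReal (by linarith)
  · intro y _
    obtain ⟨x, hx, hyx⟩ := mem_iUnion₂.1 (ht (mem_univ y))
    exact mem_iUnion₂.2 ⟨_, Finset.mem_image_of_mem _ hx, hyx⟩

open Classical in
/-- A nearly minimal separating cover is locally small. -/
lemma exists_isSeparatingCover [CompactSpace X] {K : Set X} {n : ℕ} {r δ η : ℝ} (hr : 0 < r)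
    (hδ : 0 < δ) (hδr : δ ≤ r) (hη : 0 < η)
    (h : ∀ x ∈ K, ∃ s, IsSmallCover s (K ∩ closedEBall x (ENNReal.ofReal (3 * r))) δ ∧
      ∑ p ∈ s, p.2 ^ (n + 1) ≤ η) :
    ∃ 𝒰 s, IsSeparatingCover K (6 * r) δ 𝒰 s ∧ ∀ x ∈ K,
      ∑ p ∈ s.filter (fun p ↦ (p.1 ∩ closedEBall x (ENNReal.ofReal r)).Nonempty), p.2 ^ n ≤
        2 * η / r := by
  let C : Set ℝ := {c | ∃ 𝒰 s, IsSeparatingCover K (6 * r) δ 𝒰 s ∧ ∑ p ∈ s, p.2 ^ n = c}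
  have hne : C.Nonempty := by
    obtain ⟨s, hs⟩ := exists_isSmallCover (K \ ⋃₀ ∅) hδ
    exact ⟨_, ∅, s, ⟨by simp, by simp, by simp, hs⟩, rfl⟩
  have hbdd : BddBelow C := by
    refine ⟨0, ?_⟩
    rintro _ ⟨𝒰, s, hs, rfl⟩
    exact Finset.sum_nonneg fun p hp ↦ pow_nonneg (hs.cover.pos p hp).le _
  -- The infimum need not be attained. The slack `η / r` equals the bound for the sphere below,
  -- whence the factor 2 in the conclusion.
  obtain ⟨_, ⟨𝒰, s, hs, rfl⟩, hlt⟩ := exists_lt_of_csInf_lt hne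
    (show sInf C < sInf C + η / r from lt_add_of_pos_right _ (by positivity))
  refine ⟨𝒰, s, hs, fun x hx ↦ ?_⟩
  obtain ⟨s₁, hs₁, hcost⟩ := h x hx
  obtain ⟨t, ht, s', hs', hcost'⟩ :=
    hs₁.exists_sphere (a := 2 * r) (by positivity) (by linarith) n
  have hnew := hs.insert_ball (by linarith [ht.2]) hs'
  have hinf := csInf_le hbdd ⟨_, _, hnew, rfl⟩
  have hsplit := Finset.sum_filter_add_sum_filter_not s
    (fun p ↦ p.1 ⊆ eball x (ENNReal.ofReal t)) (fun p ↦ p.2 ^ n)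
  have hunion : ∑ p ∈ (s.filter fun p ↦ ¬ p.1 ⊆ eball x (ENNReal.ofReal t)) ∪ s', p.2 ^ n ≤
      ∑ p ∈ (s.filter fun p ↦ ¬ p.1 ⊆ eball x (ENNReal.ofReal t)), p.2 ^ n +
        ∑ p ∈ s', p.2 ^ n := by
    rw [← Finset.sum_union_inter]
    exact le_add_of_nonneg_right (Finset.sum_nonneg fun p hp ↦
      pow_nonneg (hs'.pos p (Finset.mem_inter.1 hp).2).le _)
  -- A member that meets the ball of radius `r` has diameter at most `δ ≤ r`, so it lies within `2 *
  -- r < t` of `x` and is discarded by the replacement.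
  have hmeet : ∑ p ∈ s.filter (fun p ↦ (p.1 ∩ closedEBall x (ENNReal.ofReal r)).Nonempty),
      p.2 ^ n ≤ ∑ p ∈ s.filter (fun p ↦ p.1 ⊆ eball x (ENNReal.ofReal t)), p.2 ^ n := by
    refine Finset.sum_le_sum_of_subset_of_nonneg (fun p hp ↦ ?_)
      fun p hp _ ↦ pow_nonneg (hs.cover.pos p (Finset.mem_filter.1 hp).1).le _
    obtain ⟨hp, z, hzp, hzx⟩ := Finset.mem_filter.1 hp
    refine Finset.mem_filter.2 ⟨hp, fun y hy ↦ ?_⟩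
    calc edist y x ≤ edist y z + edist z x := edist_triangle _ _ _
      _ ≤ ENNReal.ofReal r + ENNReal.ofReal r := by
        gcongr
        · refine (edist_le_ediam_of_mem hy hzp).trans ((hs.cover.ediam_le p hp).trans ?_)
          exact ENNReal.ofReal_le_ofReal ((hs.cover.le p hp).trans hδr)
        · exact hzx
      _ = ENNReal.ofReal (2 * r) := by rw [← ENNReal.ofReal_add hr.le hr.le, two_mul]
      _ < ENNReal.ofReal t := (ENNReal.ofReal_lt_ofReal_iff (by linarith [ht.1])).2 ht.1
  have hs'r : ∑ p ∈ s', p.2 ^ n ≤ η / r := by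
    rw [le_div_iff₀ hr]
    linarith
  rw [mul_div_assoc]
  linarith

/-- The sum of the characteristic functions of a finite family of closed sets does not grow when
the sets are slightly thickened. -/
lemma exists_card_cthickening_le [CompactSpace X] {n : ℕ} (𝓕 : Finset (Set X))
    (hc : ∀ F ∈ 𝓕, IsClosed F)
    (hn : ∀ x, ∀ 𝓖 ⊆ 𝓕, (∀ F ∈ 𝓖, x ∈ F) → 𝓖.card ≤ n) {ρ : ℝ} (hρ : 0 < ρ) :
    ∃ ε, 0 < ε ∧ ε ≤ ρ ∧ ∀ x, ∀ 𝓖 ⊆ 𝓕,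
      (∀ F ∈ 𝓖, x ∈ cthickening ε F) → 𝓖.card ≤ n := by
  classical
  -- The open set indexed by `x` avoids every member missing `x`. If it contains the `δ`-ball of
  -- `y`, all members closer than `δ` to `y` pass through `x`.
  obtain ⟨δ, hδ, hLeb⟩ := lebesgue_number_lemma_of_emetric (s := (univ : Set X)) (ι := X)
    (c := fun x ↦ ⋂ F ∈ 𝓕.filter (x ∉ ·), Fᶜ) isCompact_univ
    (fun x ↦ isOpen_biInter_finset fun F hF ↦ (hc F (Finset.mem_filter.1 hF).1).isOpen_compl)
    (fun x _ ↦ mem_iUnion.2 ⟨x, mem_iInter₂.2 fun F hF ↦ (Finset.mem_filter.1 hF).2⟩)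
  obtain ⟨ε, hε, hεδ⟩ : ∃ ε : ℝ, 0 < ε ∧ ENNReal.ofReal ε < δ := by
    obtain ⟨q, hq0, hq⟩ := ENNReal.lt_iff_exists_nnreal_btwn.1 hδ
    exact ⟨q, by simpa using hq0, by simpa using hq⟩
  refine ⟨min ε ρ, lt_min hε hρ, min_le_right _ _, fun y 𝓖 h𝓖 hy ↦ ?_⟩
  obtain ⟨x, hx⟩ := hLeb y (mem_univ y)
  refine hn x 𝓖 h𝓖 fun F hF ↦ by_contra fun hxF ↦ ?_
  have hlt : infEDist y F < δ := (mem_cthickening_iff.1 (hy F hF)).trans_lt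
    ((ENNReal.ofReal_le_ofReal (min_le_left _ _)).trans_lt hεδ)
  obtain ⟨z, hzF, hz⟩ := infEDist_lt_iff.1 hlt
  exact mem_iInter₂.1 (hx (show z ∈ eball y δ by rwa [mem_eball, edist_comm])) F
    (Finset.mem_filter.2 ⟨h𝓖 hF, hxF⟩) hzF

end Covers

/-! ### The covering theorem, by induction on the dimension -/

section CoveringTheorem

open Set Metric

variable {X : Type*} [PseudoEMetricSpace X]

/-- A finite family of closed sets of diameter at most `R` which covers `K`, such that each point
is in at most `n` of the sets. -/
structure IsClosedCover (𝓕 : Finset (Set X)) (K : Set X) (R : ℝ) (n : ℕ) : Prop where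
  isClosed : ∀ F ∈ 𝓕, IsClosed F
  ediam_le : ∀ F ∈ 𝓕, ediam F ≤ ENNReal.ofReal R
  subset : K ⊆ ⋃ F ∈ 𝓕, F
  card_le : ∀ x, ∀ 𝓖 ⊆ 𝓕, (∀ F ∈ 𝓖, x ∈ F) → 𝓖.card ≤ n

open Classical in
/-- A closed cover of the separating set extends to a closed cover with one more set through each
point. -/
lemma IsClosedCover.extend [CompactSpace X] {K : Set X} (hK : IsClosed K) {R R' δ : ℝ} {n : ℕ}
    {𝒰 : Set (Set X)} {s : Finset (Set X × ℝ)} (h : IsSeparatingCover K R δ 𝒰 s)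
    {𝓕 : Finset (Set X)} (h𝓕 : IsClosedCover 𝓕 (K \ ⋃₀ 𝒰) R' n) (hR' : 0 ≤ R') (hR : R' < R) :
    ∃ 𝓖 : Finset (Set X), IsClosedCover 𝓖 K R (n + 1) := by
  obtain ⟨ε, hε, hεR, hcard⟩ := exists_card_cthickening_le 𝓕 h𝓕.isClosed h𝓕.card_le
    (show 0 < (R - R') / 2 by linarith)
  let C : Set X := K \ ⋃ F ∈ 𝓕, thickening ε F
  have hC : IsClosed C :=
    hK.sdiff (isOpen_biUnion fun F _ ↦ isOpen_thickening)
  have hCU : C ⊆ ⋃ U ∈ 𝒰, U := by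
    rintro y ⟨hyK, hy⟩
    rw [← sUnion_eq_biUnion]
    by_contra hyU
    obtain ⟨F, hF, hyF⟩ := mem_iUnion₂.1 (h𝓕.subset ⟨hyK, hyU⟩)
    exact hy (mem_iUnion₂.2 ⟨F, hF, self_subset_thickening hε F hyF⟩)
  obtain ⟨𝒱, h𝒱, hfin, hCV⟩ := hC.isCompact.elim_finite_subcover_image (c := id) h.isOpen hCU
  lift 𝒱 to Finset (Set X) using hfin
  let 𝓑 : Finset (Set X) := 𝒱.image (C ∩ ·)
  refine ⟨𝓕.image (cthickening ε) ∪ 𝓑, ?_, ?_, ?_, ?_⟩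
  · intro F hF
    rcases Finset.mem_union.1 hF with hF | hF
    · obtain ⟨F, -, rfl⟩ := Finset.mem_image.1 hF
      exact isClosed_cthickening
    · obtain ⟨U, hU, rfl⟩ := Finset.mem_image.1 hF
      -- The pieces are disjoint and cover `C`, so each is relatively closed in `C`.
      have : C ∩ U = C \ ⋃ V ∈ 𝒱.erase U, V := by
        ext y
        constructor
        · rintro ⟨hy, hyU⟩
          refine ⟨hy, fun hyV ↦ ?_⟩
          obtain ⟨V, hV, hyV⟩ := mem_iUnion₂.1 hyV
          obtain ⟨hne, hV⟩ := Finset.mem_erase.1 hV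
          exact disjoint_left.1 (h.disjoint (h𝒱 hV) (h𝒱 hU) hne) hyV hyU
        · rintro ⟨hy, hyV⟩
          refine ⟨hy, ?_⟩
          obtain ⟨V, hV, hyV'⟩ := mem_iUnion₂.1 (hCV hy)
          rcases eq_or_ne V U with rfl | hne
          · exact hyV'
          · exact (hyV (mem_iUnion₂.2 ⟨V, Finset.mem_erase.2 ⟨hne, hV⟩, hyV'⟩)).elim
      change IsClosed (C ∩ U)
      rw [this]
      exact hC.sdiff (isOpen_biUnion fun V hV ↦ h.isOpen V (h𝒱 (Finset.mem_erase.1 hV).2))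
  · intro F hF
    rcases Finset.mem_union.1 hF with hF | hF
    · obtain ⟨F, hF𝓕, rfl⟩ := Finset.mem_image.1 hF
      lift ε to NNReal using hε.le
      refine (ediam_cthickening_le ε).trans ?_
      calc ediam F + 2 * ε ≤ ENNReal.ofReal R' + 2 * ENNReal.ofReal ε := by
            gcongr
            · exact h𝓕.ediam_le F hF𝓕
            · simp
        _ = ENNReal.ofReal (R' + 2 * ε) := by
          rw [ENNReal.ofReal_add hR' (by positivity), ENNReal.ofReal_mul (by norm_num)]
          simp
        _ ≤ ENNReal.ofReal R := ENNReal.ofReal_le_ofReal (by linarith)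
    · obtain ⟨U, hU, rfl⟩ := Finset.mem_image.1 hF
      exact (ediam_mono inter_subset_right).trans (h.ediam_le U (h𝒱 hU))
  · intro y hy
    by_cases hyC : y ∈ C
    · obtain ⟨U, hU, hyU⟩ := mem_iUnion₂.1 (hCV hyC)
      exact mem_iUnion₂.2 ⟨C ∩ U,
        Finset.mem_union_right _ (Finset.mem_image_of_mem _ hU), hyC, hyU⟩
    · have : y ∈ ⋃ F ∈ 𝓕, thickening ε F := by_contra fun h ↦ hyC ⟨hy, h⟩
      obtain ⟨F, hF, hyF⟩ := mem_iUnion₂.1 this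
      exact mem_iUnion₂.2 ⟨_, Finset.mem_union_left _ (Finset.mem_image_of_mem _ hF),
        thickening_subset_cthickening ε F hyF⟩
  · intro y 𝓖 h𝓖 hy
    -- Disjointness allows one set of `𝓑` through `y`; the others are thickened members of `𝓕`, at
    -- most `n` by the choice of `ε`.
    have h1 : (𝓖.filter (· ∈ 𝓑)).card ≤ 1 := by
      refine Finset.card_le_one.2 fun A hA B hB ↦ ?_
      obtain ⟨hA, hAB⟩ := Finset.mem_filter.1 hA
      obtain ⟨hB, hBB⟩ := Finset.mem_filter.1 hB
      obtain ⟨U, hU, rfl⟩ := Finset.mem_image.1 hAB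
      obtain ⟨V, hV, rfl⟩ := Finset.mem_image.1 hBB
      by_contra hne
      have hUV : U ≠ V := fun h ↦ hne (by rw [h])
      exact disjoint_left.1 (h.disjoint (h𝒱 hU) (h𝒱 hV) hUV) (hy _ hA).2 (hy _ hB).2
    have h2 : 𝓖.filter (· ∉ 𝓑) ⊆
        (𝓕.filter (y ∈ cthickening ε ·)).image (cthickening ε) := by
      intro A hA
      obtain ⟨hA, hAB⟩ := Finset.mem_filter.1 hA
      obtain ⟨F, hF, rfl⟩ :=
        Finset.mem_image.1 ((Finset.mem_union.1 (h𝓖 hA)).resolve_right hAB)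
      exact Finset.mem_image_of_mem _ (Finset.mem_filter.2 ⟨hF, hy _ hA⟩)
    have h3 := (Finset.card_le_card h2).trans (Finset.card_image_le.trans
      (hcard y _ (Finset.filter_subset _ _) fun F hF ↦ (Finset.mem_filter.1 hF).2))
    have h4 := Finset.card_filter_add_card_filter_not (s := 𝓖) (· ∈ 𝓑)
    omega

/-- The constant in `exists_isClosedCover`. -/
noncomputable def coverConst : ℕ → ℝ
  | 0 => 1 / 2
  | n + 1 => coverConst n / (12 * 6 ^ n)

lemma coverConst_pos (n : ℕ) : 0 < coverConst n := by
  induction n with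
  | zero => norm_num [coverConst]
  | succ n ih => rw [coverConst]; positivity

lemma coverConst_le_one (n : ℕ) : coverConst n ≤ 1 := by
  induction n with
  | zero => norm_num [coverConst]
  | succ n ih =>
    rw [coverConst, div_le_one (by positivity)]
    have : (1 : ℝ) ≤ 6 ^ n := one_le_pow₀ (by norm_num)
    linarith

/-- A compact set whose balls of radius `R` have small `n`-dimensional content has a closed cover
by sets of diameter at most `R` with at most `n` sets through each point. -/
theorem exists_isClosedCover [CompactSpace X] (n : ℕ) {K : Set X} (hK : IsClosed K) {R : ℝ}
    (hR : 0 < R)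
    (h : ∀ x ∈ K, ∃ s, IsSmallCover s (K ∩ closedEBall x (ENNReal.ofReal R)) (coverConst n * R) ∧
      ∑ p ∈ s, p.2 ^ n ≤ coverConst n * R ^ n) :
    ∃ 𝓕, IsClosedCover 𝓕 K R n := by
  classical
  induction n generalizing K R with
  | zero =>
    have hKe : K = ∅ := by
      refine eq_empty_of_forall_notMem fun x hx ↦ ?_
      obtain ⟨s, hs, hcost⟩ := h x hx
      -- In dimension 0 the content counts the members of the cover, and a count of at most 1/2 is
      -- zero.
      have hs0 : s = ∅ := by
        by_contra hne
        have : 1 ≤ s.card := Finset.card_pos.2 (Finset.nonempty_iff_ne_empty.2 hne)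
        have : (1 : ℝ) ≤ s.card := by exact_mod_cast this
        simp only [pow_zero, Finset.sum_const, nsmul_eq_mul, mul_one, coverConst] at hcost
        linarith
      have := hs.subset ⟨hx, mem_closedEBall_self⟩
      simp [hs0] at this
    refine ⟨∅, by simp, by simp, by simp [hKe], fun x 𝓖 h𝓖 _ ↦ ?_⟩
    simp [Finset.subset_empty.1 h𝓖]
  | succ n ih =>
    have hc := coverConst_pos n
    have hc1 := coverConst_le_one n
    have h6 : (1 : ℝ) ≤ 6 ^ n := one_le_pow₀ (by norm_num)
    have hsucc : coverConst (n + 1) * R ≤ coverConst n * (R / 6) := by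
      rw [coverConst, div_mul_eq_mul_div, div_le_iff₀ (by positivity)]
      have : coverConst n * R ≤ coverConst n * R * 6 ^ n :=
        le_mul_of_one_le_right (by positivity) h6
      nlinarith
    -- The pieces have diameter at most `6 * r = R`. With this `η`, the local bound `2 * η / r` is
    -- `12 * coverConst (n + 1) * R ^ n = coverConst n * (R / 6) ^ n`, exactly the induction
    -- hypothesis at radius `R / 6`.
    obtain ⟨𝒰, s, hs, hcost⟩ := exists_isSeparatingCover (K := K) (n := n) (r := R / 6)
      (δ := coverConst n * (R / 6)) (η := coverConst (n + 1) * R ^ (n + 1)) (by positivity)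
      (by positivity) (mul_le_of_le_one_left (by positivity) hc1)
      (mul_pos (coverConst_pos _) (by positivity)) (fun x hx ↦ by
        obtain ⟨s, hs, hcost⟩ := h x hx
        refine ⟨s, (hs.mono_size hsucc).mono (inter_subset_inter_right _ ?_), hcost⟩
        exact closedEBall_subset_closedEBall (ENNReal.ofReal_le_ofReal (by linarith)))
    rw [mul_div_cancel₀ R (by norm_num : (6 : ℝ) ≠ 0)] at hs
    have hZ : IsClosed (K \ ⋃₀ 𝒰) := hK.sdiff (isOpen_sUnion hs.isOpen)
    obtain ⟨𝓕, h𝓕⟩ := ih hZ (R := R / 6) (by positivity) (fun x hx ↦ by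
      refine ⟨_, hs.cover.filter (B := (K \ ⋃₀ 𝒰) ∩ closedEBall x (ENNReal.ofReal (R / 6)))
        inter_subset_left, ?_⟩
      refine (Finset.sum_le_sum_of_subset_of_nonneg (fun p hp ↦ ?_)
        fun p hp _ ↦ pow_nonneg (hs.cover.pos p (Finset.mem_filter.1 hp).1).le _).trans
        ((hcost x hx.1).trans_eq ?_)
      · obtain ⟨hp, y, hyp, hy⟩ := Finset.mem_filter.1 hp
        exact Finset.mem_filter.2 ⟨hp, y, hyp, hy.2⟩
      · rw [coverConst, div_pow]
        field_simp
        ring)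
    exact h𝓕.extend hK hs (by positivity) (by linarith)

end CoveringTheorem

/-! ### From covers to maps into a complex -/

section Nerve

open Set Metric

/-- The `q`-skeleton of the standard simplex with `N` vertices. -/
noncomputable def simplexSkeleton (N q : ℕ) :
    Geometry.SimplicialComplex ℝ (EuclideanSpace ℝ (Fin N)) :=
  letI := Classical.decEq (EuclideanSpace ℝ (Fin N))
  .ofAffineIndependent
    { faces := {s | s.Nonempty ∧ s.card ≤ q + 1 ∧
        (s : Set (EuclideanSpace ℝ (Fin N))) ⊆ range (EuclideanSpace.basisFun (Fin N) ℝ)}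
      isRelLowerSet_faces := fun _ hs ↦ ⟨hs.1, fun _ hts ht ↦
        ⟨ht, (Finset.card_le_card hts).trans hs.2.1, (Finset.coe_subset.2 hts).trans hs.2.2⟩⟩ }
    ((EuclideanSpace.basisFun (Fin N) ℝ).orthonormal.linearIndependent.affineIndependent.range.mono
      (iUnion₂_subset fun _ hs ↦ hs.2.2))

lemma mem_faces_simplexSkeleton {N q : ℕ} {s : Finset (EuclideanSpace ℝ (Fin N))} :
    s ∈ (simplexSkeleton N q).faces ↔ s.Nonempty ∧ s.card ≤ q + 1 ∧
      (s : Set (EuclideanSpace ℝ (Fin N))) ⊆ range (EuclideanSpace.basisFun (Fin N) ℝ) :=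
  Iff.rfl

/-- The nerve map of a finite open cover of order `q`. -/
theorem hasUrysonWidthLE_of_openCover {X : Type*} [PseudoEMetricSpace X] [CompactSpace X]
    {N q : ℕ} {W : ℝ≥0∞} (U : Fin N → Set X) (hU : ∀ i, IsOpen (U i)) (hcov : ⋃ i, U i = univ)
    (hW : ∀ i, ediam (U i) ≤ W)
    (hq : ∀ x, ∀ t : Finset (Fin N), (∀ i ∈ t, x ∈ U i) → t.card ≤ q + 1) :
    HasUrysonWidthLE X q W := by
  classical
  obtain ⟨ρ, hρ⟩ := PartitionOfUnity.exists_isSubordinate isClosed_univ U hU hcov.ge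
  have hmem (x : X) (i : Fin N) (h : ρ i x ≠ 0) : x ∈ U i :=
    hρ i (subset_tsupport _ h)
  have hsum (x : X) : ∑ i, ρ i x = 1 := by
    rw [← finsum_eq_sum_of_fintype]
    exact ρ.sum_eq_one (mem_univ x)
  let b := EuclideanSpace.basisFun (Fin N) ℝ
  let f : X → EuclideanSpace ℝ (Fin N) := fun x ↦ ∑ i, ρ i x • b i
  have hfi (x : X) (i : Fin N) : f x i = ρ i x := by
    simp [f, b, Finset.sum_apply, Pi.single_apply]
  have hfc : Continuous f := by
    refine continuous_finsetSum _ fun i _ ↦ ?_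
    exact (ρ i).continuous.smul continuous_const
  have hfY (x : X) : f x ∈ (simplexSkeleton N q).space := by
    let t : Finset (Fin N) := Finset.univ.filter fun i ↦ ρ i x ≠ 0
    have hts : ∑ i ∈ t, ρ i x = 1 := by rw [Finset.sum_filter_ne_zero, hsum]
    have htf : f x = ∑ i ∈ t, ρ i x • b i := by
      refine (Finset.sum_subset (Finset.filter_subset _ _) fun i _ hi ↦ ?_).symm
      have : ρ i x = 0 := by simpa [t] using hi
      rw [this, zero_smul]
    rw [Geometry.SimplicialComplex.mem_space_iff]
    refine ⟨t.image b, mem_faces_simplexSkeleton.2 ⟨?_, ?_, ?_⟩, ?_⟩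
    · refine Finset.Nonempty.image ?_ _
      by_contra hne
      rw [Finset.not_nonempty_iff_eq_empty.1 hne] at hts
      simp at hts
    · exact Finset.card_image_le.trans (hq x t fun i hi ↦ hmem x i (Finset.mem_filter.1 hi).2)
    · rw [Finset.coe_image]
      exact image_subset_range _ _
    · rw [htf]
      exact (convex_convexHull ℝ _).sum_mem (fun i _ ↦ ρ.nonneg i x) hts fun i hi ↦
        subset_convexHull ℝ _ (Finset.mem_coe.2 (Finset.mem_image_of_mem _ hi))
  refine ⟨N, simplexSkeleton N q, fun x ↦ ⟨f x, hfY x⟩, ?_, fun s hs ↦ hs.2.1,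
    hfc.subtype_mk _, fun y ↦ ediam_le fun x hx x' hx' ↦ ?_⟩
  · refine Set.Finite.subset (Finset.finite_toSet (Finset.univ.image b).powerset) fun s hs ↦ ?_
    rw [Finset.mem_coe, Finset.mem_powerset]
    intro v hv
    obtain ⟨i, rfl⟩ := hs.2.2 hv
    exact Finset.mem_image_of_mem _ (Finset.mem_univ i)
  -- The coordinates of `f` are the partition functions, so one that is nonzero at `x` is nonzero at
  -- `x'`, and both points lie in the same `U i`.
  · have hxx' : f x = f x' := congrArg Subtype.val (hx.trans hx'.symm : _ = _)
    obtain ⟨i, -, hi⟩ := Finset.exists_ne_zero_of_sum_ne_zero (s := Finset.univ)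
      (f := fun i ↦ ρ i x) (by rw [hsum]; exact one_ne_zero)
    refine (edist_le_ediam_of_mem (hmem x i hi) (hmem x' i ?_)).trans (hW i)
    rwa [← hfi, ← hxx', hfi]

/-- A small thickening makes the cover open with the same multiplicity; the gap between `R` and `R'`
absorbs the growth of diameters. -/
theorem IsClosedCover.hasUrysonWidthLE {X : Type*} [PseudoEMetricSpace X] [CompactSpace X]
    {𝓕 : Finset (Set X)} {R R' : ℝ} {n : ℕ} (h : IsClosedCover 𝓕 univ R n) (hn : 1 ≤ n)
    (hR : 0 ≤ R) (hRR' : R < R') : HasUrysonWidthLE X (n - 1) (ENNReal.ofReal R') := by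
  obtain ⟨ε, hε, hεR, hcard⟩ := exists_card_cthickening_le 𝓕 h.isClosed h.card_le
    (show 0 < (R' - R) / 2 by linarith)
  let e := 𝓕.equivFin.symm
  refine hasUrysonWidthLE_of_openCover (N := 𝓕.card) (fun i ↦ thickening ε (e i : Set X))
    (fun i ↦ isOpen_thickening) ?_ (fun i ↦ ?_) fun x t ht ↦ ?_
  · refine eq_univ_of_forall fun x ↦ ?_
    obtain ⟨F, hF, hxF⟩ := mem_iUnion₂.1 (h.subset (mem_univ x))
    refine mem_iUnion.2 ⟨e.symm ⟨F, hF⟩, ?_⟩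
    rw [e.apply_symm_apply]
    exact self_subset_thickening hε F hxF
  · lift ε to NNReal using hε.le
    refine (ediam_thickening_le ε).trans ?_
    calc ediam (e i : Set X) + 2 * ε ≤ ENNReal.ofReal R + 2 * ENNReal.ofReal ε := by
          gcongr
          · exact h.ediam_le _ (e i).2
          · simp
      _ = ENNReal.ofReal (R + 2 * ε) := by
        rw [ENNReal.ofReal_add hR (by positivity), ENNReal.ofReal_mul (by norm_num)]
        simp
      _ ≤ ENNReal.ofReal R' := ENNReal.ofReal_le_ofReal (by linarith)
  · rw [Nat.sub_add_cancel hn]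
    have := hcard x (t.map (e.toEmbedding.trans (Function.Embedding.subtype _)))
      (fun F hF ↦ by
        obtain ⟨i, -, rfl⟩ := Finset.mem_map.1 hF
        exact (e i).2)
      (fun F hF ↦ by
        obtain ⟨i, hi, rfl⟩ := Finset.mem_map.1 hF
        exact thickening_subset_cthickening _ _ (ht i hi))
    rwa [Finset.card_map] at this

end Nerve

/-! ### Gram determinants -/

section GramDet

/-- A linear isomorphism from Euclidean space to an inner product space of the same dimension
differs by an isometry from an endomorphism whose determinant is the square root of the Gram
determinant. -/
lemma exists_linearMap_norm_eq_and_det_gram {n : ℕ} {F : Type*} [NormedAddCommGroup F]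
    [InnerProductSpace ℝ F] [FiniteDimensional ℝ F] (hF : Module.finrank ℝ F = n)
    (A : EuclideanSpace ℝ (Fin n) ≃ₗ[ℝ] F) :
    ∃ L : EuclideanSpace ℝ (Fin n) →ₗ[ℝ] EuclideanSpace ℝ (Fin n), LinearMap.det L ≠ 0 ∧
      (∀ w, ‖A w‖ = ‖L w‖) ∧
      (Matrix.gram ℝ fun i ↦ A (EuclideanSpace.single i 1)).det = LinearMap.det L ^ 2 := by
  let ι : F ≃ₗᵢ[ℝ] EuclideanSpace ℝ (Fin n) :=
    ((stdOrthonormalBasis ℝ F).reindex (finCongr hF)).repr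
  let e : EuclideanSpace ℝ (Fin n) ≃ₗ[ℝ] EuclideanSpace ℝ (Fin n) := A.trans ι.toLinearEquiv
  have he (w) : e w = ι (A w) := rfl
  refine ⟨e, (LinearEquiv.isUnit_det' e).ne_zero, fun w ↦ (ι.norm_map (A w)).symm, ?_⟩
  let b := EuclideanSpace.basisFun (Fin n) ℝ
  have hgram : (Matrix.gram ℝ fun i ↦ A (EuclideanSpace.single i 1)) =
      (LinearMap.toMatrix b.toBasis b.toBasis e).transpose *
        LinearMap.toMatrix b.toBasis b.toBasis e := by
    ext i j
    rw [Matrix.gram_apply, ← ι.inner_map_map, ← he, ← he, Matrix.mul_apply, PiLp.inner_apply]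
    refine Finset.sum_congr rfl fun k _ ↦ ?_
    simp [LinearMap.toMatrix_apply, b, mul_comm]
  rw [hgram, Matrix.det_mul, Matrix.det_transpose, LinearMap.det_toMatrix, sq]

end GramDet

/-! ### The metric in a chart -/

section LocalEstimates

open Set Metric Filter
open scoped Topology

variable {n : ℕ} {M : Type*} [TopologicalSpace M] [ChartedSpace (EuclideanSpace ℝ (Fin n)) M]
  [IsManifold (𝓡 n) ∞ M]

/-- Links the coordinate vectors, which define volume and length, with the bundle trivialization, in
which continuity of the metric is expressed. -/
lemma mfderiv_extChartAt_symm_eq_symmL (x : M) {y : EuclideanSpace ℝ (Fin n)}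
    (hy : y ∈ (extChartAt (𝓡 n) x).target) (w : EuclideanSpace ℝ (Fin n)) :
    (mfderiv 𝓘(ℝ, EuclideanSpace ℝ (Fin n)) (𝓡 n) (extChartAt (𝓡 n) x).symm y w :
      TangentSpace (𝓡 n) ((extChartAt (𝓡 n) x).symm y)) =
    (trivializationAt (EuclideanSpace ℝ (Fin n)) (TangentSpace (𝓡 n) (M := M)) x).symmL ℝ
      ((extChartAt (𝓡 n) x).symm y) w := by
  have hp : (extChartAt (𝓡 n) x).symm y ∈ (chartAt (EuclideanSpace ℝ (Fin n)) x).source := by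
    rw [← extChartAt_source (𝓡 n)]
    exact (extChartAt (𝓡 n) x).map_target hy
  rw [TangentBundle.symmL_trivializationAt hp]
  have key : ∀ z, z = y →
      (mfderiv 𝓘(ℝ, EuclideanSpace ℝ (Fin n)) (𝓡 n) (extChartAt (𝓡 n) x).symm y w :
        EuclideanSpace ℝ (Fin n)) =
      (mfderivWithin 𝓘(ℝ, EuclideanSpace ℝ (Fin n)) (𝓡 n) (extChartAt (𝓡 n) x).symm
        (range (𝓡 n)) z w : EuclideanSpace ℝ (Fin n)) := by
    rintro _ rfl
    rw [ModelWithCorners.range_eq_univ, mfderivWithin_univ]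
  exact key _ ((extChartAt (𝓡 n) x).right_inv hy)


instance (x : M) : FiniteDimensional ℝ (TangentSpace (𝓡 n) x) :=
  inferInstanceAs (FiniteDimensional ℝ (EuclideanSpace ℝ (Fin n)))

variable [RiemannianBundle (fun x : M ↦ TangentSpace (𝓡 n) x)]

/-- The Gram matrix of the frame at `p` given by the trivialization at `x`. -/
noncomputable def frameGram (x p : M) : Matrix (Fin n) (Fin n) ℝ :=
  Matrix.gram ℝ fun i ↦ (trivializationAt (EuclideanSpace ℝ (Fin n))
    (TangentSpace (𝓡 n) (M := M)) x).symmL ℝ p (EuclideanSpace.single i 1)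

lemma metricMatrix_eq_frameGram (x : M) {y : EuclideanSpace ℝ (Fin n)}
    (hy : y ∈ (extChartAt (𝓡 n) x).target) :
    metricMatrix x y = frameGram x ((extChartAt (𝓡 n) x).symm y) := by
  unfold metricMatrix frameGram
  congr 1
  funext i
  exact mfderiv_extChartAt_symm_eq_symmL x hy _

/-- The metric at `x`, read in the chart at `x`, is the pullback of the Euclidean metric by a
linear map. -/
lemma exists_linearMap_norm_symmL_eq (x : M) :
    ∃ L : EuclideanSpace ℝ (Fin n) →ₗ[ℝ] EuclideanSpace ℝ (Fin n), LinearMap.det L ≠ 0 ∧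
      (∀ w, ‖(trivializationAt (EuclideanSpace ℝ (Fin n))
        (TangentSpace (𝓡 n) (M := M)) x).symmL ℝ x w‖ = ‖L w‖) ∧
      (frameGram (n := n) x x).det = LinearMap.det L ^ 2 := by
  have hx := FiberBundle.mem_baseSet_trivializationAt (F := EuclideanSpace ℝ (Fin n))
    (E := TangentSpace (𝓡 n) (M := M)) x
  have hF : Module.finrank ℝ (TangentSpace (𝓡 n) x) = n :=
    finrank_euclideanSpace_fin (𝕜 := ℝ) (n := n)
  obtain ⟨L, hL, hnorm, hdet⟩ := exists_linearMap_norm_eq_and_det_gram hF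
    ((trivializationAt (EuclideanSpace ℝ (Fin n)) (TangentSpace (𝓡 n) (M := M))
      x).continuousLinearEquivAt ℝ x hx).symm.toLinearEquiv
  have hcoe := (trivializationAt (EuclideanSpace ℝ (Fin n)) (TangentSpace (𝓡 n) (M := M))
      x).symm_continuousLinearEquivAt_eq (R := ℝ) hx
  refine ⟨L, hL, fun w ↦ ?_, ?_⟩
  · rw [← hnorm, ← hcoe]
    rfl
  · rw [← hdet, frameGram, ← hcoe]
    rfl

/-- On a convex set where the metric is at most `4 ‖L ·‖²`, the Riemannian distance is bounded by
the length of segments. -/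
lemma riemannianEDist_extChartAt_symm_le {x : M}
    {L : EuclideanSpace ℝ (Fin n) →ₗ[ℝ] EuclideanSpace ℝ (Fin n)}
    {V : Set (EuclideanSpace ℝ (Fin n))} (hV : Convex ℝ V)
    (hVt : V ⊆ (extChartAt (𝓡 n) x).target)
    (hL : ∀ y ∈ V, ∀ w : EuclideanSpace ℝ (Fin n),
      ‖(mfderiv 𝓘(ℝ, EuclideanSpace ℝ (Fin n)) (𝓡 n) (extChartAt (𝓡 n) x).symm y w :
        TangentSpace (𝓡 n) ((extChartAt (𝓡 n) x).symm y))‖ ≤ 2 * ‖L w‖)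
    {a b : EuclideanSpace ℝ (Fin n)} (ha : a ∈ V) (hb : b ∈ V) :
    Manifold.riemannianEDist (𝓡 n) ((extChartAt (𝓡 n) x).symm a) ((extChartAt (𝓡 n) x).symm b) ≤
      ENNReal.ofReal (2 * ‖L (b - a)‖) := by
  let η := ContinuousAffineMap.lineMap (R := ℝ) a b
  have hη : Icc 0 1 ⊆ η ⁻¹' V := by
    simp only [← image_subset_iff, ContinuousAffineMap.coe_lineMap_eq,
      ← segment_eq_image_lineMap, η]
    exact hV.segment_subset ha hb
  have hηt : Icc 0 1 ⊆ η ⁻¹' (extChartAt (𝓡 n) x).target := hη.trans (preimage_mono hVt)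
  have hηs : ContMDiffOn 𝓘(ℝ, ℝ) 𝓘(ℝ, EuclideanSpace ℝ (Fin n)) 1 η (Icc 0 1) := by
    apply ContMDiff.contMDiffOn
    rw [contMDiff_iff_contDiff]
    exact ContinuousAffineMap.contDiff _
  have hle : Manifold.riemannianEDist (𝓡 n) ((extChartAt (𝓡 n) x).symm a) ((extChartAt (𝓡 n) x).symm b) ≤
      Manifold.pathELength (𝓡 n) ((extChartAt (𝓡 n) x).symm ∘ η) 0 1 := by
    apply Manifold.riemannianEDist_le_pathELength _ _ _ zero_le_one
    · exact (contMDiffOn_extChartAt_symm x).comp hηs hηt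
    · simp [η, ContinuousAffineMap.coe_lineMap_eq]
    · simp [η, ContinuousAffineMap.coe_lineMap_eq]
  refine hle.trans ?_
  rw [Manifold.pathELength_eq_lintegral_mfderivWithin_Icc]
  refine (setLIntegral_mono' (g := fun _ ↦ ENNReal.ofReal (2 * ‖L (b - a)‖)) measurableSet_Icc
    fun t ht ↦ ?_).trans (by simp)
  have hd : mfderivWithin 𝓘(ℝ, ℝ) (𝓡 n) ((extChartAt (𝓡 n) x).symm ∘ η) (Icc 0 1) t =
      (mfderiv 𝓘(ℝ, EuclideanSpace ℝ (Fin n)) (𝓡 n) (extChartAt (𝓡 n) x).symm (η t)) ∘L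
        (mfderivWithin 𝓘(ℝ, ℝ) 𝓘(ℝ, EuclideanSpace ℝ (Fin n)) η (Icc 0 1) t) := by
    apply mfderiv_comp_mfderivWithin
    · have := mdifferentiableWithinAt_extChartAt_symm (I := 𝓡 n) (hηt ht)
      rwa [ModelWithCorners.range_eq_univ, mdifferentiableWithinAt_univ] at this
    · exact hηs.mdifferentiableOn one_ne_zero t ht
    · rw [uniqueMDiffWithinAt_iff_uniqueDiffWithinAt]
      exact uniqueDiffOn_Icc zero_lt_one t ht
  have hη₀ : fderiv ℝ η t 1 = b - a := by
    rw [ContinuousAffineMap.fderiv, ContinuousAffineMap.coe_contLinear]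
    simp [η]
  have hη' : mfderivWithin 𝓘(ℝ, ℝ) 𝓘(ℝ, EuclideanSpace ℝ (Fin n)) η (Icc 0 1) t (1 : ℝ) =
      b - a := by
    rw [mfderivWithin_eq_fderivWithin,
      fderivWithin_eq_fderiv (uniqueDiffOn_Icc zero_lt_one t ht)
        (ContinuousAffineMap.differentiableAt _)]
    exact hη₀
  rw [hd, ← ofReal_norm]
  refine ENNReal.ofReal_le_ofReal ?_
  refine (hL (η t) (hη ht) _).trans_eq ?_
  exact congrArg (fun v ↦ 2 * ‖L v‖) hη'

variable [IsContinuousRiemannianBundle (EuclideanSpace ℝ (Fin n))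
  (fun x : M ↦ TangentSpace (𝓡 n) x)]

/-- The frame is constant when read in the trivialization at `x`, and the metric is continuous. -/
lemma continuousAt_frameGram (x : M) : ContinuousAt (frameGram (n := n) x) x := by
  have hframe (w : EuclideanSpace ℝ (Fin n)) : ContinuousAt (fun p : M ↦
      (⟨p, (trivializationAt (EuclideanSpace ℝ (Fin n))
        (TangentSpace (𝓡 n) (M := M)) x).symmL ℝ p w⟩ :
          TotalSpace (EuclideanSpace ℝ (Fin n)) (TangentSpace (𝓡 n) (M := M)))) x := by
    rw [FiberBundle.continuousAt_totalSpace]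
    refine ⟨continuousAt_id, ?_⟩
    refine (continuousAt_const (y := w)).congr ?_
    filter_upwards [(trivializationAt (EuclideanSpace ℝ (Fin n))
      (TangentSpace (𝓡 n) (M := M)) x).open_baseSet.mem_nhds
        (FiberBundle.mem_baseSet_trivializationAt' x)] with p hp
    rw [Trivialization.symmL_apply _ hp, Trivialization.apply_mk_symm _ hp]
  refine continuousAt_pi.2 fun i ↦ continuousAt_pi.2 fun j ↦ ?_
  exact (hframe _).inner_bundle (hframe _)

/-- Near `x`, the metric in the chart at `x` is at most `4` times the metric at `x`, and its volume
density is at least half of the density at `x`. -/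
lemma exists_linearMap_eventually (x : M) :
    ∃ L : EuclideanSpace ℝ (Fin n) →ₗ[ℝ] EuclideanSpace ℝ (Fin n), LinearMap.det L ≠ 0 ∧
      ∀ᶠ y in 𝓝 (extChartAt (𝓡 n) x x), y ∈ (extChartAt (𝓡 n) x).target ∧
        (∀ w : EuclideanSpace ℝ (Fin n), ‖(mfderiv 𝓘(ℝ, EuclideanSpace ℝ (Fin n)) (𝓡 n)
          (extChartAt (𝓡 n) x).symm y w :
            TangentSpace (𝓡 n) ((extChartAt (𝓡 n) x).symm y))‖ ≤ 2 * ‖L w‖) ∧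
        |LinearMap.det L| / 2 ≤ √(metricMatrix x y).det := by
  obtain ⟨L, hL, hnorm, hdet⟩ := exists_linearMap_norm_symmL_eq (n := n) x
  refine ⟨L, hL, ?_⟩
  have hx := FiberBundle.mem_baseSet_trivializationAt (F := EuclideanSpace ℝ (Fin n))
    (E := TangentSpace (𝓡 n) (M := M)) x
  have htend : Tendsto (extChartAt (𝓡 n) x).symm (𝓝 (extChartAt (𝓡 n) x x)) (𝓝 x) := by
    simpa using (continuousAt_extChartAt_symm (I := 𝓡 n) x).tendsto
  have h1 := htend.eventually (eventually_norm_symmL_trivializationAt_comp_self_lt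
    (EuclideanSpace ℝ (Fin n)) (TangentSpace (𝓡 n) (M := M)) x one_lt_two)
  have hsqrt : ContinuousAt (fun p ↦ √(frameGram (n := n) x p).det) x :=
    (Continuous.matrix_det continuous_id).continuousAt.comp (continuousAt_frameGram x) |>.sqrt
  have h2 := htend.eventually (hsqrt.eventually_const_lt
    (show |LinearMap.det L| / 2 < √(frameGram (n := n) x x).det by
      rw [hdet, Real.sqrt_sq_eq_abs]
      exact half_lt_self (abs_pos.2 hL)))
  filter_upwards [h1, h2, extChartAt_target_mem_nhds (I := 𝓡 n) x] with y hy1 hy2 hy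
  refine ⟨hy, fun w ↦ ?_, ?_⟩
  · rw [mfderiv_extChartAt_symm_eq_symmL x hy w, ← hnorm]
    -- The vector `w` is lifted to the fibre at `x` and read back in the trivialization, so that the
    -- operator bound 2 between the fibres applies.
    refine le_trans (le_of_eq ?_) ((ContinuousLinearMap.le_opNorm _
      ((trivializationAt (EuclideanSpace ℝ (Fin n)) (TangentSpace (𝓡 n) (M := M)) x).symmL ℝ x
        w)).trans (mul_le_mul_of_nonneg_right hy1.le (norm_nonneg _)))
    rw [ContinuousLinearMap.comp_apply, Trivialization.continuousLinearMapAt_symmL _ hx]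
  · rw [metricMatrix_eq_frameGram x hy]
    exact hy2.le

end LocalEstimates

/-! ### Volume of small balls from below -/

section VolumeOfBalls

open Set Metric Filter
open scoped Topology

/-- A lower bound for the volume of small balls over `radius ^ n`, valid in every Riemannian manifold
of dimension `n`. -/
noncomputable def ballConst (n : ℕ) : ℝ :=
  (volume (ball (0 : EuclideanSpace ℝ (Fin n)) 1)).toReal / 2 ^ (n + 1)

lemma ballConst_pos (n : ℕ) : 0 < ballConst n :=
  div_pos (ENNReal.toReal_pos (measure_ball_pos _ _ one_pos).ne' measure_ball_lt_top.ne)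
    (by positivity)

variable {n : ℕ}

/-- The determinant cancels, so the bound does not depend on the metric. In `ballConst`, one factor
1/2 comes from the density and `n` of them from the radius `δ / 2`. -/
lemma volume_preimage_ball_eq {L : EuclideanSpace ℝ (Fin n) →ₗ[ℝ] EuclideanSpace ℝ (Fin n)}
    (hL : LinearMap.det L ≠ 0) (a : EuclideanSpace ℝ (Fin n)) {δ : ℝ} (hδ : 0 < δ) :
    ENNReal.ofReal (|LinearMap.det L| / 2) * volume (L ⁻¹' ball a (δ / 2)) =
      ENNReal.ofReal (ballConst n * δ ^ n) := by
  rw [Measure.addHaar_preimage_linearMap _ hL, Measure.addHaar_ball_of_pos _ _ (half_pos hδ),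
    finrank_euclideanSpace_fin, ← ENNReal.ofReal_toReal (measure_ball_lt_top (μ := volume)
      (x := (0 : EuclideanSpace ℝ (Fin n))) (r := 1)).ne, ← ENNReal.ofReal_mul (by positivity),
    ← ENNReal.ofReal_mul (by positivity), ← ENNReal.ofReal_mul (by positivity), ballConst]
  congr 1
  have : |LinearMap.det L| ≠ 0 := abs_ne_zero.2 hL
  rw [abs_inv, div_pow, pow_succ]
  field_simp

variable {M : Type*} [EMetricSpace M] [ChartedSpace (EuclideanSpace ℝ (Fin n)) M]
  [RiemannianBundle (fun x : M ↦ TangentSpace (𝓡 n) x)] [MeasurableSpace M] [BorelSpace M]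

/-- A lower bound for the Riemannian volume of a set which contains the image of a set in a
chart. -/
lemma mul_volume_le_riemannianVolume (x : M) {D : Set (EuclideanSpace ℝ (Fin n))} {B : Set M}
    (hD : MeasurableSet D) (hDt : D ⊆ (extChartAt (𝓡 n) x).target)
    (hDB : MapsTo (extChartAt (𝓡 n) x).symm D B) {c : ℝ}
    (hc : ∀ y ∈ D, c ≤ √(metricMatrix x y).det) :
    ENNReal.ofReal c * volume D ≤ riemannianVolume n M B := by
  have hm : AEMeasurable (extChartAt (𝓡 n) x).symm
      (volume.restrict (extChartAt (𝓡 n) x).target) :=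
    (continuousOn_extChartAt_symm (I := 𝓡 n) x).aemeasurable
      (isOpen_extChartAt_target (I := 𝓡 n) x).measurableSet
  calc ENNReal.ofReal c * volume D
      = ∫⁻ _ in D, ENNReal.ofReal c := (setLIntegral_const _ _).symm
    _ ≤ ∫⁻ y in D, ENNReal.ofReal (√(metricMatrix x y).det) :=
      setLIntegral_mono' hD fun y hy ↦ ENNReal.ofReal_le_ofReal (hc y hy)
    _ = ((volume.restrict (extChartAt (𝓡 n) x).target).withDensity fun y ↦
          ENNReal.ofReal (√(metricMatrix x y).det)) D := by
      rw [withDensity_apply _ hD, Measure.restrict_restrict hD, inter_eq_left.2 hDt]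
    _ ≤ ((volume.restrict (extChartAt (𝓡 n) x).target).withDensity fun y ↦
          ENNReal.ofReal (√(metricMatrix x y).det)) ((extChartAt (𝓡 n) x).symm ⁻¹' B) :=
      measure_mono hDB
    _ ≤ chartVolume (n := n) x B :=
      Measure.le_map_apply (hm.mono_ac (withDensity_absolutelyContinuous _ _)) _
    _ ≤ riemannianVolume n M B := le_iSup (fun x : M ↦ chartVolume (n := n) x) x B

variable [IsManifold (𝓡 n) ∞ M] [IsRiemannianManifold (𝓡 n) M]
  [IsContinuousRiemannianBundle (EuclideanSpace ℝ (Fin n)) (fun x : M ↦ TangentSpace (𝓡 n) x)]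

/-- Lengths near `x` are at most twice those measured by `L`, so the ellipsoid of `L`-radius `δ / 2`
around the coordinates of `z` maps into the `δ`-ball of `z`; on it the density is at least `|det L|
/ 2`. -/
lemma eventually_le_riemannianVolume_eball (x : M) :
    ∃ δ₀ > 0, ∀ᶠ z in 𝓝 x, ∀ δ, 0 < δ → δ ≤ δ₀ →
      ENNReal.ofReal (ballConst n * δ ^ n) ≤
        riemannianVolume n M (eball z (ENNReal.ofReal δ)) := by
  obtain ⟨L, hdet, hL⟩ := exists_linearMap_eventually (n := n) x
  obtain ⟨ρ, hρ, hball⟩ := Metric.eventually_nhds_iff_ball.1 hL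
  obtain ⟨K, hK, hanti⟩ := L.exists_antilipschitzWith
    (LinearMap.ker_eq_bot.2 (LinearEquiv.ofIsUnitDet (f := L) (v :=
      (EuclideanSpace.basisFun (Fin n) ℝ).toBasis) (v' :=
      (EuclideanSpace.basisFun (Fin n) ℝ).toBasis) (by
        rw [LinearMap.det_toMatrix]; exact hdet.isUnit)).injective)
  have hKpos : (0 : ℝ) < K := hK
  -- The ellipsoid then has Euclidean radius at most `K * δ / 2 ≤ ρ / 2`, and its centre is within
  -- `ρ / 2` of the coordinates of `x`.
  refine ⟨ρ / K, by positivity, ?_⟩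
  filter_upwards [extChartAt_source_mem_nhds (I := 𝓡 n) x,
    (continuousAt_extChartAt (I := 𝓡 n) x).eventually (ball_mem_nhds _ (half_pos hρ))]
    with z hz hzρ δ hδ hδ₀
  set a := extChartAt (𝓡 n) x z
  have hza : (extChartAt (𝓡 n) x).symm a = z := (extChartAt (𝓡 n) x).left_inv hz
  have hsub : L ⁻¹' ball (L a) (δ / 2) ⊆ ball (extChartAt (𝓡 n) x x) ρ := by
    intro y hy
    have h1 : dist y a ≤ K * dist (L y) (L a) := hanti.le_mul_dist y a
    have h2 : K * dist (L y) (L a) < K * (δ / 2) := mul_lt_mul_of_pos_left hy hKpos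
    have h3 : δ * K ≤ ρ := (le_div_iff₀ hKpos).1 hδ₀
    have h4 : dist a (extChartAt (𝓡 n) x x) < ρ / 2 := hzρ
    have h5 := dist_triangle y a (extChartAt (𝓡 n) x x)
    rw [mem_ball]
    linarith
  rw [← volume_preimage_ball_eq hdet (L a) hδ]
  refine mul_volume_le_riemannianVolume x
    (isOpen_ball.preimage L.continuous_of_finiteDimensional).measurableSet
    (fun y hy ↦ (hball y (hsub hy)).1) (fun y hy ↦ ?_) fun y hy ↦ (hball y (hsub hy)).2.2
  have hd := riemannianEDist_extChartAt_symm_le (convex_ball _ ρ) (fun y hy ↦ (hball y hy).1)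
    (fun y hy ↦ (hball y hy).2.1) (hsub hy) (hsub (mem_ball_self (half_pos hδ) : L a ∈ _))
  rw [hza, ← IsRiemannianManifold.out] at hd
  refine hd.trans_lt ((ENNReal.ofReal_lt_ofReal_iff hδ).2 ?_)
  have h2 : dist (L y) (L a) < δ / 2 := hy
  rw [dist_comm, dist_eq_norm, ← map_sub] at h2
  linarith

/-- In a compact Riemannian manifold, the volume of small balls is bounded below, with a constant
which depends only on the dimension. -/
theorem exists_le_riemannianVolume_eball [CompactSpace M] :
    ∃ δ₀ > 0, ∀ (z : M) (δ : ℝ), 0 < δ → δ ≤ δ₀ →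
      ENNReal.ofReal (ballConst n * δ ^ n) ≤
        riemannianVolume n M (eball z (ENNReal.ofReal δ)) := by
  have := isCompact_univ.induction_on (X := M)
    (p := fun s ↦ ∃ δ₀ > 0, ∀ z ∈ s, ∀ δ : ℝ, 0 < δ → δ ≤ δ₀ →
      ENNReal.ofReal (ballConst n * δ ^ n) ≤ riemannianVolume n M (eball z (ENNReal.ofReal δ)))
    ⟨1, one_pos, by simp⟩
    (fun s t hst ⟨δ₀, h₀, h⟩ ↦ ⟨δ₀, h₀, fun z hz ↦ h z (hst hz)⟩)
    (fun s t ⟨δ₀, h₀, h⟩ ⟨δ₁, h₁, h'⟩ ↦ ⟨min δ₀ δ₁, lt_min h₀ h₁, fun z hz δ hδ hle ↦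
      hz.elim (fun hz ↦ h z hz δ hδ (hle.trans (min_le_left _ _)))
        fun hz ↦ h' z hz δ hδ (hle.trans (min_le_right _ _))⟩)
    (fun x _ ↦ by
      obtain ⟨δ₀, h₀, h⟩ := eventually_le_riemannianVolume_eball (n := n) x
      exact ⟨_, mem_nhdsWithin_of_mem_nhds h, δ₀, h₀, fun z hz ↦ hz⟩)
  obtain ⟨δ₀, h₀, h⟩ := this
  exact ⟨δ₀, h₀, fun z ↦ h z (mem_univ z)⟩

end VolumeOfBalls

/-! ### From volume to content by packing -/

section Packing

open Set Metric

/-- If balls of radius `δ / 2` have measure at least `c (δ / 2) ^ n`, then a ball of small measure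
has a cover by balls of radius `δ` with small `n`-dimensional size. -/
lemma exists_isSmallCover_of_measure_le {X : Type*} [PseudoEMetricSpace X] [CompactSpace X]
    [MeasurableSpace X] [OpensMeasurableSpace X] (μ : Measure X) {n : ℕ} {c δ r v : ℝ}
    (hc : 0 < c) (hδ : 0 < δ) (hr : 0 ≤ r) (hv : 0 ≤ v)
    (h : ∀ y, ENNReal.ofReal (c * (δ / 2) ^ n) ≤ μ (eball y (ENNReal.ofReal (δ / 2)))) (x : X)
    (hx : μ (eball x (ENNReal.ofReal (r + δ))) ≤ ENNReal.ofReal v) :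
    ∃ s, IsSmallCover s (closedEBall x (ENNReal.ofReal r)) (2 * δ) ∧
      ∑ p ∈ s, p.2 ^ n ≤ 4 ^ n / c * v := by
  classical
  lift δ to NNReal using hδ.le
  have hδ' : (δ : NNReal) ≠ 0 := by
    rintro rfl
    simp at hδ
  set A := closedEBall x (ENNReal.ofReal r)
  have hpack : packingNumber δ A ≠ ⊤ := by
    obtain ⟨N, -, hNfin, hN⟩ := exists_finite_isCover_of_isCompact
      (show δ / 2 ≠ 0 by simpa using hδ') (isClosed_closedEBall : IsClosed A).isCompact
    have h1 := packingNumber_two_mul_le_externalCoveringNumber (δ / 2) A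
    rw [mul_div_cancel₀ _ (two_ne_zero)] at h1
    exact ne_top_of_le_ne_top hNfin.encard_lt_top.ne
      (h1.trans hN.externalCoveringNumber_le_encard)
  have hfin : (maximalSeparatedSet δ A).Finite := by
    rw [← encard_lt_top_iff, encard_maximalSeparatedSet hpack]
    exact hpack.lt_top
  have hsub : maximalSeparatedSet δ A ⊆ A := maximalSeparatedSet_subset
  have hsep : IsSeparated δ (maximalSeparatedSet δ A) := isSeparated_maximalSeparatedSet
  have hcov : IsCover δ A (maximalSeparatedSet δ A) := isCover_maximalSeparatedSet hpack
  generalize maximalSeparatedSet δ A = T at hfin hsub hsep hcov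
  lift T to Finset X using hfin
  have hhalf : ENNReal.ofReal (δ / 2) + ENNReal.ofReal (δ / 2) = δ := by
    rw [← ENNReal.ofReal_add (by positivity) (by positivity), add_halves]
    simp
  have hdisj : (T : Set X).PairwiseDisjoint fun y ↦ eball y (ENNReal.ofReal (δ / 2)) := by
    intro y hy z hz hyz
    refine disjoint_left.2 fun w hwy hwz ↦ ?_
    refine (hsep hy hz hyz).not_ge ((edist_triangle_left y z w).trans ?_)
    rw [← hhalf]
    exact add_le_add (le_of_lt hwy) (le_of_lt hwz)
  -- The balls of radius `δ / 2` around the separated points are disjoint and lie in the ball of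
  -- radius `r + δ`.
  have hcard : (T.card : ℝ) * (c * (δ / 2) ^ n) ≤ v := by
    have hle : ∑ _y ∈ T, ENNReal.ofReal (c * (δ / 2) ^ n) ≤ ENNReal.ofReal v := by
      calc ∑ _y ∈ T, ENNReal.ofReal (c * (δ / 2) ^ n)
          ≤ ∑ y ∈ T, μ (eball y (ENNReal.ofReal (δ / 2))) := Finset.sum_le_sum fun y _ ↦ h y
        _ = μ (⋃ y ∈ T, eball y (ENNReal.ofReal (δ / 2))) :=
          (measure_biUnion_finset hdisj fun y _ ↦ isOpen_eball.measurableSet).symm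
        _ ≤ μ (eball x (ENNReal.ofReal (r + δ))) := by
          refine measure_mono (iUnion₂_subset fun y hy w hw ↦ ?_)
          have hyx : edist y x ≤ ENNReal.ofReal r := hsub hy
          rw [mem_eball, ENNReal.ofReal_add hr hδ.le, add_comm]
          refine (edist_triangle w y x).trans_lt
            (ENNReal.add_lt_add_of_lt_of_le (ne_top_of_le_ne_top ENNReal.ofReal_ne_top hyx)
              (lt_of_lt_of_le hw (ENNReal.ofReal_le_ofReal (half_le_self hδ.le))) hyx)
        _ ≤ ENNReal.ofReal v := hx
    rw [← ENNReal.ofReal_sum_of_nonneg fun _ _ ↦ by positivity,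
      ENNReal.ofReal_le_ofReal_iff hv] at hle
    simpa using hle
  refine ⟨T.image fun y ↦ (closedEBall y δ, 2 * (δ : ℝ)), ⟨?_, ?_, ?_, ?_⟩, ?_⟩
  · simp only [Finset.mem_image]
    rintro _ ⟨y, -, rfl⟩
    positivity
  · simp only [Finset.mem_image]
    rintro _ ⟨y, -, rfl⟩
    exact le_rfl
  · simp only [Finset.mem_image]
    rintro _ ⟨y, -, rfl⟩
    refine ediam_closedEBall_le.trans_eq ?_
    rw [ENNReal.ofReal_mul (by norm_num)]
    simp
  · intro y hy
    obtain ⟨z, hz, hyz⟩ := mem_iUnion₂.1 (isCover_iff_subset_iUnion_closedEBall.1 hcov hy)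
    exact mem_iUnion₂.2 ⟨_, Finset.mem_image_of_mem _ hz, hyz⟩
  · have hsum : ∑ p ∈ T.image fun y ↦ (closedEBall y (δ : ℝ≥0∞), 2 * (δ : ℝ)), p.2 ^ n ≤
        T.card * (2 * (δ : ℝ)) ^ n := by
      rw [← nsmul_eq_mul]
      refine (Finset.sum_le_card_nsmul _ _ ((2 * (δ : ℝ)) ^ n) fun p hp ↦ ?_).trans
        (nsmul_le_nsmul_left (by positivity) Finset.card_image_le)
      obtain ⟨y, -, rfl⟩ := Finset.mem_image.1 hp
      exact le_rfl
    refine hsum.trans ?_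
    have h4 : (2 * (δ : ℝ)) ^ n = 4 ^ n * (δ / 2) ^ n := by rw [← mul_pow]; ring
    rw [h4, div_mul_eq_mul_div, le_div_iff₀ hc]
    calc T.card * (4 ^ n * ((δ : ℝ) / 2) ^ n) * c
        = 4 ^ n * (T.card * (c * (δ / 2) ^ n)) := by ring
      _ ≤ 4 ^ n * v := by gcongr

end Packing

theorem mainTheorem1 (n : ℕ) (hn : 1 ≤ n) :
    ∃ ε : ℝ, 0 < ε ∧
      ∀ (M : Type*) [EMetricSpace M] [CompactSpace M]
        [ChartedSpace (EuclideanSpace ℝ (Fin n)) M] [IsManifold (𝓡 n) ∞ M]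
        [RiemannianBundle (fun x : M ↦ TangentSpace (𝓡 n) x)]
        [IsContMDiffRiemannianBundle (𝓡 n) ∞ (EuclideanSpace ℝ (Fin n))
          (fun x : M ↦ TangentSpace (𝓡 n) x)]
        [IsRiemannianManifold (𝓡 n) M] [MeasurableSpace M] [BorelSpace M] (R : ℝ),
        0 < R →
        (∀ x : M, riemannianVolume n M (Metric.eball x (ENNReal.ofReal R)) ≤
          ENNReal.ofReal (ε * R ^ n)) →
        HasUrysonWidthLE M (n - 1) (ENNReal.ofReal R) := by
  have hb := ballConst_pos n
  have hc := coverConst_pos n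
  have hc1 := coverConst_le_one n
  -- Packing costs `4 ^ n / ballConst n`, and the covering theorem is used at radius `R / 2`, which
  -- costs `2 ^ n` and leaves room for the thickening before the nerve map.
  refine ⟨coverConst n * ballConst n / 8 ^ n, by positivity, ?_⟩
  intro M _ _ _ _ _ _ _ _ _ R hR hvol
  have : IsContinuousRiemannianBundle (EuclideanSpace ℝ (Fin n))
    (fun x : M ↦ TangentSpace (𝓡 n) x) := by
    obtain ⟨g, hg, hgv⟩ := IsContMDiffRiemannianBundle.exists_contMDiff (IB := 𝓡 n) (n := ∞)
      (F := EuclideanSpace ℝ (Fin n)) (E := fun x : M ↦ TangentSpace (𝓡 n) x)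
    exact ⟨g, hg.continuous, hgv⟩
  obtain ⟨δ₀, hδ₀, hball⟩ := exists_le_riemannianVolume_eball (n := n) (M := M)
  -- The covering sets have size `2 * δ`, which must not exceed `coverConst n * (R / 2)`; moreover
  -- `R / 2 + δ ≤ R`.
  let δ := min δ₀ (coverConst n * R / 4)
  have hδ : 0 < δ := lt_min hδ₀ (by positivity)
  have hδR : 4 * δ ≤ coverConst n * R := by
    have := min_le_right δ₀ (coverConst n * R / 4)
    linarith
  have hδR' : 4 * δ ≤ R := hδR.trans (mul_le_of_le_one_left hR.le hc1)
  obtain ⟨𝓕, h𝓕⟩ := exists_isClosedCover n (K := (Set.univ : Set M)) isClosed_univ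
    (half_pos hR) fun x _ ↦ by
      obtain ⟨s, hs, hsum⟩ := exists_isSmallCover_of_measure_le (riemannianVolume n M) (n := n)
        (r := R / 2) hb hδ (by positivity) (by positivity)
        (fun y ↦ hball y (δ / 2) (half_pos hδ)
          ((half_le_self hδ.le).trans (min_le_left _ _))) x
        ((measure_mono (Metric.eball_subset_eball
          (ENNReal.ofReal_le_ofReal (by linarith)))).trans (hvol x))
      refine ⟨s, (hs.mono_size (by linarith)).mono Set.inter_subset_right, hsum.trans_eq ?_⟩
      have h8 : (8 : ℝ) ^ n = 4 ^ n * 2 ^ n := by rw [← mul_pow]; norm_num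
      rw [h8, div_pow]
      field_simp
  exact h𝓕.hasUrysonWidthLE hn (by positivity) (half_lt_self hR)
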